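/- Let $\ell\geqslant 1$ be an integer, put $\lambda=\ell+1$, and consider the binary constant-length substitution $a\mapsto ab^{\ell}$, $b\mapsto a^{\ell+1}$, both letters being represented by intervals of length $1$. For $i,j\in\{a,b\}$ let $T_{ij}\subset\{0,\dots,\ell\}$ be the set of positions (counted from $0$) at which the letter $i$ occurs in the image of the letter $j$, and let $$B(k)=\Bigl(\sum_{t\in T_{ij}}\mathrm{e}^{2\pi\mathrm{i}tk}\Bigr)_{i,j\in\{a,b\}}\in\mathrm{Mat}(2,\mathbb{C}),\qquad k\in\mathbb{R},$$ be the associated Fourier matrix. Let $\|\cdot\|$ be the Frobenius norm. Then, for Lebesgue-almost every $k\in\mathbb{R}$, all matrices $B(\lambda^{n}k)$ with $n\geqslant 0$ are invertible, and the extremal Lyapunov exponents of the outward iteration $v(\lambda^{n}k)=\lambda^{n/2}B^{-1}(\lambda^{n-1}k)\cdots B^{-1}(\lambda k)B^{-1}(k)\,v(k)$, defined by $$\chi_{\max}(k)=\log\sqrt{\lambda}+\limsup_{n\to\infty}\frac1n\log\bigl\|B^{-1}(\lambda^{n-1}k)\cdots B^{-1}(\lambda k)B^{-1}(k)\bigr\|,$$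 $$\chi_{\min}(k)=\log\sqrt{\lambda}-\limsup_{n\to\infty}\frac1n\log\bigl\|B(k)B(\lambda k)\cdots B(\lambda^{n-1}k)\bigr\|,$$ satisfy $$\chi_{\min}(k)=\chi_{\max}(k)=\log\sqrt{\ell+1}.$$ -/

import Mathlib

open scoped Matrix

/-- The substitution `a ↦ a b^ℓ`, `b ↦ a^(ℓ+1)`, with the letters `a` and `b` written
as `0` and `1`. -/
def constLengthSubst (ℓ : ℕ) : Fin 2 → List (Fin 2) :=
  ![0 :: List.replicate ℓ 1, List.replicate (ℓ + 1) 0]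

/-- The displacement set `T i j` of a substitution of constant length, with both tiles
represented by unit intervals: the positions of the tiles of type `i` in the supertile
of type `j`, measured between left endpoints. -/
def displacementSet (σ : Fin 2 → List (Fin 2)) (i j : Fin 2) : Finset ℕ :=
  (Finset.range (σ j).length).filter fun t => (σ j)[t]? = some i

/-- The Fourier matrix `B k`, with entries `∑ t ∈ T i j, exp (2 π i t k)`. -/
noncomputable def fourierMatrix (σ : Fin 2 → List (Fin 2)) (k : ℝ) :
    Matrix (Fin 2) (Fin 2) ℂ :=
  Matrix.of fun i j =>
    ∑ t ∈ displacementSet σ i j,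
      Complex.exp (2 * (Real.pi : ℂ) * Complex.I * (t : ℂ) * (k : ℂ))

/-- The matrix cocycle `B(k) B(λk) ⋯ B(λ^(n-1) k)`. -/
noncomputable def inwardProduct (B : ℝ → Matrix (Fin 2) (Fin 2) ℂ) (lam k : ℝ) :
    ℕ → Matrix (Fin 2) (Fin 2) ℂ
  | 0 => 1
  | n + 1 => inwardProduct B lam k n * B (lam ^ n * k)

/-- The product `B⁻¹(λ^(n-1) k) ⋯ B⁻¹(λk) B⁻¹(k)` of the outward iteration
`v(λ^n k) = λ^(n/2) B⁻¹(λ^(n-1) k) ⋯ B⁻¹(k) v(k)`. -/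
noncomputable def outwardProduct (B : ℝ → Matrix (Fin 2) (Fin 2) ℂ) (lam k : ℝ) :
    ℕ → Matrix (Fin 2) (Fin 2) ℂ
  | 0 => 1
  | n + 1 => (B (lam ^ n * k))⁻¹ * outwardProduct B lam k n

section Exponents

open scoped Matrix.Norms.Frobenius

/-- The maximal Lyapunov exponent of the outward iteration, as an extended real, so that the
upper limit is always the genuine one. -/
noncomputable def chiMax (B : ℝ → Matrix (Fin 2) (Fin 2) ℂ) (lam k : ℝ) : EReal :=
  (Real.log (Real.sqrt lam) : EReal) +
    Filter.limsup
      (fun n : ℕ => ((1 / (n : ℝ) * Real.log ‖outwardProduct B lam k n‖ : ℝ) : EReal))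
      Filter.atTop

/-- The minimal Lyapunov exponent of the outward iteration, as an extended real. -/
noncomputable def chiMin (B : ℝ → Matrix (Fin 2) (Fin 2) ℂ) (lam k : ℝ) : EReal :=
  (Real.log (Real.sqrt lam) : EReal) -
    Filter.limsup
      (fun n : ℕ => ((1 / (n : ℝ) * Real.log ‖inwardProduct B lam k n‖ : ℝ) : EReal))
      Filter.atTop

end Exponents

/-! Put z = e^{2πik} and p = 1 + z + … + z^ℓ. The Fourier matrix has rows (1, p) and (p - 1, 0), so
(1, 1) is a left eigenvector for every k, with eigenvalue p. The cocycle is thus triangular in a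
fixed basis, with diagonal entries p and 1 - p. Since |p| = |1 - z^(ℓ+1)| / |1 - z| and |1 - p| = |1
- z^ℓ| / |1 - z|, the diagonal products have exponential rate 0 once the averages of log |1 - e^{2πi
m λ^j k}| vanish for m = 1, ℓ, ℓ + 1 (`ae_tendsto_average_log_norm_one_sub_exp`).

These averages are Birkhoff averages of f(x) = log |1 - e^{2πix}| under x ↦ λx. The factorisation of
1 - w^λ over roots of unity makes f an eigenfunction of the transfer operator
(`integral_logNormOneSub_mul_comp_nsmul`). Its correlations therefore decay geometrically, and a
second-moment argument gives the strong law.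

The off-diagonal part is built from sums of ratios of the diagonal products, hence is
subexponential. The bound |det A| ≤ ‖A‖² excludes exponential decay of the norm, and ‖A⁻¹‖ = ‖A‖ /
|det A| transfers the result to the outward product. Both upper limits are limits, equal to 0. -/

open MeasureTheory Filter Topology

/-! ### Strong law from geometric decay of correlations -/

theorem tendsto_div_atTop_zero_of_sq {s : ℕ → ℝ} {C : ℝ} (hs : ∀ n, s (n + 1) ≤ s n + C)
    (h : Tendsto (fun n : ℕ => s (n ^ 2) / (n ^ 2 : ℕ)) atTop (𝓝 0)) :
    Tendsto (fun n : ℕ => s n / n) atTop (𝓝 0) := by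
  -- The one-sided bound makes `C * n - s n` monotone. For a monotone sequence it suffices to
  -- converge along indices whose consecutive ratios tend to 1, such as the squares.
  have key : Tendsto (fun n : ℕ => (C * n - s n) / n) atTop (𝓝 C) := by
    refine tendsto_div_of_monotone_of_exists_subseq_tendsto_div (fun n : ℕ => C * n - s n) C
      (monotone_nat_of_le_succ fun n => ?_) fun a ha => ⟨fun n => n ^ 2, ?_, ?_, ?_⟩
    · have := hs n
      push_cast
      linarith
    · have h1 : Tendsto (fun n : ℕ => (1 + 1 / (n : ℝ)) ^ 2) atTop (𝓝 1) := by
        simpa using (tendsto_one_div_atTop_nhds_zero_nat.const_add (1 : ℝ)).pow 2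
      filter_upwards [h1.eventually_le_const ha, eventually_gt_atTop 0] with n hn hpos
      have hpos' : (0 : ℝ) < n := by exact_mod_cast hpos
      calc (((n + 1) ^ 2 : ℕ) : ℝ) = (1 + 1 / (n : ℝ)) ^ 2 * (n ^ 2 : ℕ) := by
            push_cast; field_simp
        _ ≤ a * (n ^ 2 : ℕ) := by gcongr
    · exact tendsto_pow_atTop two_ne_zero
    · have h2 := h.const_sub C
      rw [sub_zero] at h2
      refine h2.congr' ?_
      filter_upwards [eventually_gt_atTop 0] with n hpos
      have hpos' : (0 : ℝ) < n := by exact_mod_cast hpos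
      push_cast
      field_simp
  have h3 := key.const_sub C
  rw [sub_self] at h3
  refine h3.congr' ?_
  filter_upwards [eventually_gt_atTop 0] with n hpos
  have hpos' : (0 : ℝ) < n := by exact_mod_cast hpos
  field_simp
  ring

section

variable {X : Type*} [MeasurableSpace X] {μ : Measure X}

theorem ae_tendsto_zero_of_integral_sq_le {u : ℕ → X → ℝ} {b : ℕ → ℝ}
    (hu : ∀ n, MemLp (u n) 2 μ) (hb : Summable b) (h : ∀ n, ∫ x, u n x ^ 2 ∂μ ≤ b n) :
    ∀ᵐ x ∂μ, Tendsto (fun n => u n x) atTop (𝓝 0) := by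
  have hint : ∀ n, Integrable (fun x => u n x ^ 2) μ := fun n => (hu n).integrable_sq
  have hfin : ∑' n, ∫⁻ x, ENNReal.ofReal (u n x ^ 2) ∂μ ≠ ⊤ := by
    have hle : ∀ n, ∫⁻ x, ENNReal.ofReal (u n x ^ 2) ∂μ ≤ ENNReal.ofReal (b n) := fun n => by
      rw [← ofReal_integral_eq_lintegral_ofReal (hint n) (ae_of_all _ fun x => sq_nonneg _)]
      exact ENNReal.ofReal_le_ofReal (h n)
    refine ne_top_of_le_ne_top ?_ (ENNReal.tsum_le_tsum hle)
    exact hb.tsum_ofReal_ne_top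
  rw [← lintegral_tsum fun n => (hint n).aestronglyMeasurable.aemeasurable.ennreal_ofReal] at hfin
  have hae := ae_lt_top' (AEMeasurable.tsum fun n =>
    (hint n).aestronglyMeasurable.aemeasurable.ennreal_ofReal) hfin
  filter_upwards [hae] with x hx
  have h0 := ENNReal.tendsto_atTop_zero_of_tsum_ne_top hx.ne
  have h1 : Tendsto (fun n => u n x ^ 2) atTop (𝓝 0) := by
    have := (ENNReal.tendsto_toReal ENNReal.zero_ne_top).comp h0
    simpa [Function.comp_def, ENNReal.toReal_ofReal, sq_nonneg] using this
  have h2 := h1.sqrt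
  simp only [Real.sqrt_sq_eq_abs, Real.sqrt_zero] at h2
  exact (tendsto_zero_iff_abs_tendsto_zero _).2 h2

theorem memLp_birkhoffSum {T : X → X} {f : X → ℝ} (hT : MeasurePreserving T μ μ)
    (hf : MemLp f 2 μ) (n : ℕ) : MemLp (birkhoffSum T f n) 2 μ := by
  have : birkhoffSum T f n = fun x => ∑ j ∈ Finset.range n, (f ∘ T^[j]) x := rfl
  rw [this]
  exact memLp_finsetSum _ fun j _ => hf.comp_measurePreserving (hT.iterate j)

/-- Let A = ∫ f² and expand S_{n+1} = f + S_n ∘ T. By `H` the numbers x_n = ∫ f S_n satisfy x_{n+1}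
= A + c x_n with x_0 = 0, so x_n ≤ 2A because c ≤ 1/2. Each step then adds A + 2c x_n ≤ 3A to the
second moment. -/
theorem integral_birkhoffSum_sq_le {T : X → X} {f : X → ℝ} {c : ℝ}
    (hT : MeasurePreserving T μ μ) (hf : MemLp f 2 μ) (hc0 : 0 ≤ c) (hc : c ≤ 1 / 2)
    (H : ∀ g : X → ℝ, MemLp g 2 μ → ∫ x, f x * g (T x) ∂μ = c * ∫ x, f x * g x ∂μ) (n : ℕ) :
    ∫ x, birkhoffSum T f n x ^ 2 ∂μ ≤ 3 * (∫ x, f x ^ 2 ∂μ) * n := by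
  set A := ∫ x, f x ^ 2 ∂μ with hA
  have hA0 : 0 ≤ A := integral_nonneg fun x => sq_nonneg _
  have hS := memLp_birkhoffSum hT hf
  have hfS : ∀ n, Integrable (fun x => f x * birkhoffSum T f n (T x)) μ := fun n =>
    hf.integrable_mul ((hS n).comp_measurePreserving hT)
  have hcorr : ∀ n, ∫ x, f x * birkhoffSum T f n x ∂μ ≤ 2 * A := by
    intro n
    induction n with
    | zero => simpa [birkhoffSum_zero] using hA0
    | succ n ih =>
      have : ∫ x, f x * birkhoffSum T f (n + 1) x ∂μ
          = A + c * ∫ x, f x * birkhoffSum T f n x ∂μ := by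
        rw [← H _ (hS n), hA, ← integral_add hf.integrable_sq (hfS n)]
        congr 1 with x
        rw [birkhoffSum_succ']
        ring
      rw [this]
      nlinarith
  induction n with
  | zero => simp [birkhoffSum_zero]
  | succ n ih =>
    have hST : ∫ x, birkhoffSum T f n (T x) ^ 2 ∂μ = ∫ x, birkhoffSum T f n x ^ 2 ∂μ := by
      have h := integral_map (μ := μ) hT.measurable.aemeasurable
        (f := fun x => birkhoffSum T f n x ^ 2)
        (by rw [hT.map_eq]; exact (hS n).integrable_sq.aestronglyMeasurable)
      rw [hT.map_eq] at h
      exact h.symm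
    have : ∫ x, birkhoffSum T f (n + 1) x ^ 2 ∂μ
        = A + 2 * (c * ∫ x, f x * birkhoffSum T f n x ∂μ) + ∫ x, birkhoffSum T f n x ^ 2 ∂μ := by
      have h1 : Integrable (fun x => f x ^ 2 + 2 * (f x * birkhoffSum T f n (T x))) μ :=
        hf.integrable_sq.add ((hfS n).const_mul 2)
      have h2 : Integrable (fun x => birkhoffSum T f n (T x) ^ 2) μ :=
        ((hS n).comp_measurePreserving hT).integrable_sq
      rw [← H _ (hS n), ← hST, hA, ← integral_const_mul,
        ← integral_add hf.integrable_sq ((hfS n).const_mul 2), ← integral_add h1 h2]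
      congr 1 with x
      rw [birkhoffSum_succ']
      ring
    rw [this]
    push_cast
    nlinarith [hcorr n]

/-- A strong law of large numbers for a square-integrable function, bounded above, whose
correlations decay geometrically along a measure-preserving map. -/
theorem ae_tendsto_birkhoffSum_div {T : X → X} {f : X → ℝ} {c C : ℝ}
    (hT : MeasurePreserving T μ μ) (hf : MemLp f 2 μ) (hfC : ∀ x, f x ≤ C)
    (hc0 : 0 ≤ c) (hc : c ≤ 1 / 2)
    (H : ∀ g : X → ℝ, MemLp g 2 μ → ∫ x, f x * g (T x) ∂μ = c * ∫ x, f x * g x ∂μ) :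
    ∀ᵐ x ∂μ, Tendsto (fun n : ℕ => birkhoffSum T f n x / n) atTop (𝓝 0) := by
  set A := ∫ x, f x ^ 2 ∂μ with hA
  have hA0 : 0 ≤ A := integral_nonneg fun x => sq_nonneg _
  have hsum : Summable fun n : ℕ => 3 * A * (1 / (n : ℝ) ^ 2) :=
    (Real.summable_one_div_nat_pow.2 one_lt_two).mul_left _
  -- Along the squares the normalised second moments are at most 3A / n², which is summable; the
  -- upper bound `C` on `f` later fills the gaps.
  have hae := ae_tendsto_zero_of_integral_sq_le (μ := μ)
    (u := fun n x => birkhoffSum T f (n ^ 2) x / (n ^ 2 : ℕ))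
    (fun n => by
      simpa only [div_eq_inv_mul] using (memLp_birkhoffSum hT hf (n ^ 2)).const_mul _) hsum
    (fun n => by
      simp only [div_pow]
      rw [integral_div]
      have h := integral_birkhoffSum_sq_le hT hf hc0 hc H (n ^ 2)
      rcases Nat.eq_zero_or_pos n with rfl | hn
      · simp
      have hn' : (0 : ℝ) < n := by exact_mod_cast hn
      rw [div_le_iff₀ (by positivity)]
      refine h.trans (le_of_eq ?_)
      push_cast
      field_simp
      rfl)
  filter_upwards [hae] with x hx
  refine tendsto_div_atTop_zero_of_sq (C := C) (fun n => ?_) hx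
  rw [birkhoffSum_succ]
  linarith [hfC (T^[n] x)]

end

/-! ### Square-integrability of log |1 - e^{2πix}| -/

theorem log_sq_le_one_add_rpow {t : ℝ} (h0 : 0 ≤ t) (h2 : t ≤ 2) :
    Real.log t ^ 2 ≤ 1 + 16 * t ^ (-(1 / 2) : ℝ) := by
  rcases h0.eq_or_lt with rfl | hpos
  · simp
  have hp : 0 < t ^ (-(1 / 2) : ℝ) := Real.rpow_pos_of_pos hpos _
  rcases le_total t 1 with h1 | h1
  · have h := Real.abs_log_mul_self_rpow_lt t (1 / 4) hpos h1 (by norm_num)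
    have hsq : (Real.log t * t ^ (1 / 4 : ℝ)) ^ 2 ≤ 16 := by
      rw [← sq_abs]
      nlinarith [abs_nonneg (Real.log t * t ^ (1 / 4 : ℝ))]
    have e1 : (t ^ (1 / 4 : ℝ)) ^ 2 * t ^ (-(1 / 2) : ℝ) = 1 := by
      rw [← Real.rpow_natCast, ← Real.rpow_mul h0, ← Real.rpow_add hpos]
      norm_num
    calc Real.log t ^ 2 = (Real.log t * t ^ (1 / 4 : ℝ)) ^ 2 * t ^ (-(1 / 2) : ℝ) := by
          rw [mul_pow, mul_assoc, e1, mul_one]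
      _ ≤ 16 * t ^ (-(1 / 2) : ℝ) := by gcongr
      _ ≤ _ := by linarith
  · have hl := Real.log_le_sub_one_of_pos hpos
    have hl0 := Real.log_nonneg h1
    nlinarith

/-- The function `x ↦ log |1 - exp (2 π i x)|` on the circle `ℝ / ℤ`. -/
noncomputable def logNormOneSub (x : UnitAddCircle) : ℝ :=
  Real.log ‖1 - (AddCircle.toCircle x : ℂ)‖

theorem logNormOneSub_coe (k : ℝ) :
    logNormOneSub k = Real.log ‖1 - Complex.exp (2 * Real.pi * Complex.I * k)‖ := by
  rw [logNormOneSub, AddCircle.toCircle_apply_mk, Circle.coe_exp]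
  congr 4
  push_cast
  ring

theorem measurable_logNormOneSub : Measurable logNormOneSub := by
  have : Continuous fun x : UnitAddCircle => ‖1 - (AddCircle.toCircle x : ℂ)‖ :=
    (continuous_const.sub (continuous_induced_dom.comp AddCircle.continuous_toCircle)).norm
  exact Real.measurable_log.comp this.measurable

theorem norm_one_sub_toCircle_le (x : UnitAddCircle) :
    ‖1 - (AddCircle.toCircle x : ℂ)‖ ≤ 2 := by
  refine (norm_sub_le _ _).trans ?_
  rw [norm_one, Circle.norm_coe]
  norm_num

theorem logNormOneSub_le (x : UnitAddCircle) : logNormOneSub x ≤ 1 := by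
  have h := norm_one_sub_toCircle_le x
  rcases (norm_nonneg (1 - (AddCircle.toCircle x : ℂ))).eq_or_lt with h0 | h0
  · rw [logNormOneSub, ← h0, Real.log_zero]
    exact zero_le_one
  · exact (Real.log_le_sub_one_of_pos h0).trans (by linarith)

theorem abs_le_norm_one_sub_toCircle {x : ℝ} (hx : |x| ≤ 1 / 2) :
    |x| ≤ ‖1 - (AddCircle.toCircle (x : UnitAddCircle) : ℂ)‖ := by
  have hpi := Real.pi_pos
  have h1 : ‖1 - (AddCircle.toCircle (x : UnitAddCircle) : ℂ)‖ = 2 * |Real.sin (Real.pi * x)| := by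
    rw [AddCircle.toCircle_apply_mk, Circle.coe_exp, norm_sub_rev, mul_comm _ Complex.I,
      Complex.norm_exp_I_mul_ofReal_sub_one, norm_mul, Real.norm_eq_abs, Real.norm_eq_abs, abs_two]
    congr 3
    ring
  have h2 := Real.mul_abs_le_abs_sin (x := Real.pi * x) (by
    rw [abs_mul, abs_of_pos hpi]
    nlinarith)
  rw [abs_mul, abs_of_pos hpi] at h2
  have h3 : 2 / Real.pi * (Real.pi * |x|) = 2 * |x| := by field_simp
  rw [h1]
  linarith [abs_nonneg x]

theorem memLp_logNormOneSub : MemLp logNormOneSub 2 volume := by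
  rw [memLp_two_iff_integrable_sq measurable_logNormOneSub.aestronglyMeasurable]
  rw [← (UnitAddCircle.measurePreserving_mk (-(1 / 2))).integrable_comp
    (measurable_logNormOneSub.pow_const 2).aestronglyMeasurable]
  have hdom : IntervalIntegrable (fun x : ℝ => 1 + 16 * |x| ^ (-(1 / 2) : ℝ)) volume
      (-(1 / 2)) (1 / 2) := by
    refine intervalIntegrable_const.add (IntervalIntegrable.const_mul ?_ 16)
    refine intervalIntegrable_of_even (fun x => by rw [abs_neg]) fun x hx => ?_
    refine (intervalIntegral.intervalIntegrable_rpow' (r := -(1 / 2)) (by norm_num)).congr ?_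
    intro y hy
    rw [Set.uIoc_of_le hx.le] at hy
    simp only [abs_of_pos hy.1]
  rw [intervalIntegrable_iff_integrableOn_Ioc_of_le (by norm_num)] at hdom
  have he : (-(1 / 2) + 1 : ℝ) = 1 / 2 := by norm_num
  rw [he]
  refine hdom.mono' ((measurable_logNormOneSub.pow_const 2).comp
    AddCircle.measurable_mk').aestronglyMeasurable ?_
  refine (ae_restrict_iff' measurableSet_Ioc).2 (ae_of_all _ fun x hx => ?_)
  have hx' : |x| ≤ 1 / 2 := abs_le.2 ⟨hx.1.le, hx.2⟩
  rw [Function.comp_apply, Real.norm_eq_abs, abs_of_nonneg (sq_nonneg _)]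
  -- At 0 the values `Real.log 0 = 0` and `0 ^ (-1/2) = 0` are defaults, so monotonicity of negative
  -- powers is unavailable there.
  rcases eq_or_ne x 0 with rfl | h0
  · simp [logNormOneSub]
  refine (log_sq_le_one_add_rpow (norm_nonneg _) (norm_one_sub_toCircle_le _)).trans ?_
  have := Real.rpow_le_rpow_of_nonpos (abs_pos.2 h0) (abs_le_norm_one_sub_toCircle hx')
    (show (-(1 / 2) : ℝ) ≤ 0 by norm_num)
  linarith

/-! ### The transfer operator eigenfunction on the circle -/

theorem IsPrimitiveRoot.one_sub_pow_eq_prod_range {K : Type*} [Field K] {ζ : K} {n : ℕ}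
    (h : IsPrimitiveRoot ζ n) (hn : 0 < n) (z : K) :
    1 - z ^ n = ∏ i ∈ Finset.range n, (1 - ζ ^ i * z) := by
  have := h.pow_sub_pow_eq_prod_sub_mul 1 z hn
  rw [one_pow] at this
  rw [this]
  refine (Finset.prod_nbij (fun i => ζ ^ i) (fun i _ => ?_) (fun i hi j hj hij => ?_)
    (fun x hx => ?_) fun _ _ => rfl).symm
  · rw [Polynomial.mem_nthRootsFinset hn, ← pow_mul, mul_comm, pow_mul, h.pow_eq_one, one_pow]
  · exact h.pow_inj (by simpa using hi) (by simpa using hj) hij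
  · have : NeZero n := ⟨hn.ne'⟩
    obtain ⟨i, hi, rfl⟩ := h.eq_pow_of_pow_eq_one
      ((Polynomial.mem_nthRootsFinset hn 1).1 (by simpa using hx))
    exact ⟨i, by simpa using hi, rfl⟩

/-- Logarithm of the factorisation of 1 - z^n. The condition `n • x ≠ 0` keeps every factor nonzero;
otherwise `Real.log 0 = 0` would break additivity. -/
theorem sum_logNormOneSub_add {n : ℕ} (hn : 0 < n) {x : UnitAddCircle} (hx : n • x ≠ 0) :
    ∑ i ∈ Finset.range n, logNormOneSub (x + ((i / n : ℝ) : UnitAddCircle))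
      = logNormOneSub (n • x) := by
  have hζ := Complex.isPrimitiveRoot_exp n hn.ne'
  have hz : (1 : ℂ) - (AddCircle.toCircle x : ℂ) ^ n ≠ 0 := by
    intro h
    apply hx
    apply AddCircle.injective_toCircle one_ne_zero
    rw [AddCircle.toCircle_nsmul, AddCircle.toCircle_zero]
    ext
    simpa using (sub_eq_zero.1 h).symm
  have hprod := hζ.one_sub_pow_eq_prod_range hn (AddCircle.toCircle x : ℂ)
  have hterm : ∀ i : ℕ, logNormOneSub (x + ((i / n : ℝ) : UnitAddCircle))
      = Real.log ‖1 - Complex.exp (2 * Real.pi * Complex.I / n) ^ i * AddCircle.toCircle x‖ := by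
    intro i
    rw [logNormOneSub, AddCircle.toCircle_add, AddCircle.toCircle_apply_mk, Circle.coe_mul,
      Circle.coe_exp, ← Complex.exp_nat_mul, mul_comm (AddCircle.toCircle x : ℂ)]
    congr 5
    push_cast
    ring
  simp only [hterm]
  rw [← Real.log_prod, ← norm_prod, ← hprod, logNormOneSub, AddCircle.toCircle_nsmul,
    Circle.coe_pow]
  rw [hprod, Finset.prod_ne_zero_iff] at hz
  exact fun i hi => norm_ne_zero_iff.2 (hz i hi)

theorem UnitAddCircle.measurePreserving_nsmul {n : ℕ} (hn : 1 < n) :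
    MeasurePreserving (fun x : UnitAddCircle => n • x) volume volume :=
  (AddCircle.ergodic_nsmul (T := 1) hn).toMeasurePreserving

theorem UnitAddCircle.ae_ne_zero : ∀ᵐ x : UnitAddCircle, x ≠ 0 := by
  have h0 : volume ({0} : Set UnitAddCircle) = 0 := by
    rw [← Metric.closedBall_zero, AddCircle.volume_closedBall]
    simp
  exact measure_eq_zero_iff_ae_notMem.1 h0

theorem ae_nsmul_ne_zero {n : ℕ} (hn : 1 < n) : ∀ᵐ x : UnitAddCircle, n • x ≠ 0 := by
  have := (UnitAddCircle.measurePreserving_nsmul hn).quasiMeasurePreserving.ae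
    UnitAddCircle.ae_ne_zero
  exact this

/-- Translation by i/n does not change g(n • x). Averaging over these translations replaces the
logarithm by its fibre average, 1/n times its value at n • x, and invariance of the measure removes
the map. -/
theorem integral_logNormOneSub_mul_comp_nsmul {n : ℕ} (hn : 1 < n) {g : UnitAddCircle → ℝ}
    (hg : MemLp g 2 volume) :
    ∫ x, logNormOneSub x * g (n • x) = (1 / n : ℝ) * ∫ x, logNormOneSub x * g x := by
  have hn0 : (n : ℝ) ≠ 0 := by positivity
  have hT := UnitAddCircle.measurePreserving_nsmul hn
  have hint : Integrable fun x : UnitAddCircle => logNormOneSub x * g (n • x) :=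
    memLp_logNormOneSub.integrable_mul (hg.comp_measurePreserving hT)
  have hshift : ∀ (i : ℕ) (x : UnitAddCircle),
      n • (x + ((i / n : ℝ) : UnitAddCircle)) = n • x := by
    intro i x
    have : n • ((i / n : ℝ) : UnitAddCircle) = 0 := by
      rw [← AddCircle.coe_nsmul, nsmul_eq_mul, mul_div_cancel₀ _ hn0]
      exact (AddCircle.coe_eq_zero_iff 1).2 ⟨i, by simp⟩
    rw [nsmul_add, this, add_zero]
  have htr : ∀ i : ℕ, ∫ x, logNormOneSub (x + ((i / n : ℝ) : UnitAddCircle)) * g (n • x)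
      = ∫ x, logNormOneSub x * g (n • x) := by
    intro i
    have := integral_add_right_eq_self (μ := volume)
      (fun x => logNormOneSub x * g (n • x)) ((i / n : ℝ) : UnitAddCircle)
    simpa only [hshift] using this
  have hinti : ∀ i : ℕ, Integrable fun x : UnitAddCircle =>
      logNormOneSub (x + ((i / n : ℝ) : UnitAddCircle)) * g (n • x) := by
    intro i
    have := hint.comp_add_right ((i / n : ℝ) : UnitAddCircle)
    simpa only [hshift] using this
  have hsum : (n : ℝ) * ∫ x, logNormOneSub x * g (n • x) = ∫ x, logNormOneSub x * g x := by
    calc (n : ℝ) * ∫ x, logNormOneSub x * g (n • x)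
        = ∑ i ∈ Finset.range n,
            ∫ x, logNormOneSub (x + ((i / n : ℝ) : UnitAddCircle)) * g (n • x) := by
          simp [htr]
      _ = ∫ x, logNormOneSub (n • x) * g (n • x) := by
          rw [← integral_finsetSum _ fun i _ => hinti i]
          refine integral_congr_ae ?_
          filter_upwards [ae_nsmul_ne_zero hn] with x hx
          rw [← Finset.sum_mul, sum_logNormOneSub_add (by lia) hx]
      _ = ∫ x, logNormOneSub x * g x := by
          have h := integral_map (μ := volume) hT.measurable.aemeasurable
            (f := fun x => logNormOneSub x * g x)
            (by rw [hT.map_eq]; exact (memLp_logNormOneSub.integrable_mul hg).1)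
          rw [hT.map_eq] at h
          exact h.symm
  rw [← hsum]
  field_simp

theorem ae_tendsto_birkhoffSum_logNormOneSub {n : ℕ} (hn : 1 < n) :
    ∀ᵐ x : UnitAddCircle,
      Tendsto (fun N : ℕ => birkhoffSum (n • · ) logNormOneSub N x / N) atTop (𝓝 0) := by
  have hn' : (2 : ℝ) ≤ n := by exact_mod_cast hn
  refine ae_tendsto_birkhoffSum_div (c := 1 / n) (C := 1)
    (UnitAddCircle.measurePreserving_nsmul hn) memLp_logNormOneSub logNormOneSub_le
    (by positivity) (one_div_le_one_div_of_le two_pos hn') fun g hg => ?_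
  exact integral_logNormOneSub_mul_comp_nsmul hn hg

/-! ### From the circle to the real line -/

theorem UnitAddCircle.ae_coe {p : UnitAddCircle → Prop} (h : ∀ᵐ x, p x) :
    ∀ᵐ k : ℝ, p k := by
  have h1 : ∀ m : ℤ, ∀ᵐ k : ℝ, k ∈ Set.Ioc (m : ℝ) (m + 1) → p k := fun m =>
    (ae_restrict_iff' measurableSet_Ioc).1
      ((UnitAddCircle.measurePreserving_mk m).quasiMeasurePreserving.ae h)
  filter_upwards [ae_all_iff.2 h1] with k hk
  refine hk (⌈k⌉ - 1) ⟨?_, ?_⟩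
  · push_cast
    linarith [Int.ceil_lt_add_one k]
  · push_cast
    linarith [Int.le_ceil k]

/-- For almost every real `k`, the averages of `log |1 - exp (2 π i m lam ^ j k)|` over `j < n`
tend to zero. -/
theorem ae_tendsto_average_log_norm_one_sub_exp {lam m : ℕ} (hlam : 1 < lam) (hm : m ≠ 0) :
    ∀ᵐ k : ℝ, Tendsto (fun n : ℕ => (∑ j ∈ Finset.range n,
      Real.log ‖1 - Complex.exp (2 * Real.pi * Complex.I * ((m * (lam ^ j * k) : ℝ) : ℂ))‖) / n)
        atTop (𝓝 0) := by
  have h := UnitAddCircle.ae_coe (ae_tendsto_birkhoffSum_logNormOneSub hlam)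
  have hm' : (m : ℝ) ≠ 0 := by exact_mod_cast hm
  have hq : Measure.QuasiMeasurePreserving (fun k : ℝ => (m : ℝ) * k) volume volume := by
    refine ⟨measurable_const_mul _, ?_⟩
    rw [Real.map_volume_mul_left hm']
    exact Measure.smul_absolutelyContinuous
  filter_upwards [hq.ae h] with k hk
  refine hk.congr fun n => ?_
  congr 1
  refine Finset.sum_congr rfl fun j _ => ?_
  rw [← logNormOneSub_coe, smul_iterate]
  congr 1
  simp only
  rw [← AddCircle.coe_nsmul, nsmul_eq_mul]
  congr 1
  push_cast
  ring

/-! ### Subexponential sequences -/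

/-- A sequence of complex numbers that grows more slowly than every exponential. -/
def IsSubexponential (u : ℕ → ℂ) : Prop :=
  ∀ ε : ℝ, 0 < ε → u =O[atTop] fun n : ℕ => Real.exp (ε * n)

namespace IsSubexponential

variable {u v : ℕ → ℂ}

theorem add (hu : IsSubexponential u) (hv : IsSubexponential v) :
    IsSubexponential fun n => u n + v n :=
  fun ε hε => (hu ε hε).add (hv ε hε)

theorem neg (hu : IsSubexponential u) : IsSubexponential fun n => -u n :=
  fun ε hε => (hu ε hε).neg_left

theorem sub (hu : IsSubexponential u) (hv : IsSubexponential v) :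
    IsSubexponential fun n => u n - v n :=
  fun ε hε => (hu ε hε).sub (hv ε hε)

theorem mul (hu : IsSubexponential u) (hv : IsSubexponential v) :
    IsSubexponential fun n => u n * v n := fun ε hε => by
  refine ((hu (ε / 2) (half_pos hε)).mul (hv (ε / 2) (half_pos hε))).congr_right fun n => ?_
  rw [← Real.exp_add]
  congr 1
  ring

theorem comp_add_one (hu : IsSubexponential u) : IsSubexponential fun n => u (n + 1) :=
  fun ε hε => by
    refine ((hu ε hε).comp_tendsto (tendsto_add_atTop_nat 1)).trans
      (Asymptotics.IsBigO.of_bound (Real.exp ε) (Eventually.of_forall fun n => ?_))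
    simp only [Function.comp_apply, Real.norm_eq_abs, Real.abs_exp]
    rw [← Real.exp_add]
    push_cast
    exact Real.exp_le_exp.2 (by linarith)

/-- Half of the rate ε bounds the terms; the other half absorbs their number n. -/
theorem sum_range (hu : IsSubexponential u) :
    IsSubexponential fun n => ∑ j ∈ Finset.range n, u j := fun ε hε => by
  obtain ⟨C, hC, h⟩ := Asymptotics.bound_of_isBigO_nat_atTop (hu (ε / 2) (half_pos hε))
  refine Asymptotics.IsBigO.of_bound (C * (2 / ε)) (Eventually.of_forall fun n => ?_)
  have h1 : ∀ j ∈ Finset.range n, ‖u j‖ ≤ C * Real.exp (ε / 2 * n) := fun j hj => by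
    refine (h (Real.exp_ne_zero _)).trans ?_
    rw [Real.norm_eq_abs, Real.abs_exp]
    have : (j : ℝ) ≤ n := by exact_mod_cast (Finset.mem_range.1 hj).le
    gcongr
  have h2 : (n : ℝ) ≤ 2 / ε * Real.exp (ε / 2 * n) := by
    have := Real.add_one_le_exp (ε / 2 * n)
    rw [div_mul_eq_mul_div, le_div_iff₀ hε]
    linarith
  calc ‖∑ j ∈ Finset.range n, u j‖ ≤ n • (C * Real.exp (ε / 2 * n)) := by
        simpa using norm_sum_le_of_le _ h1
    _ ≤ (2 / ε * Real.exp (ε / 2 * n)) * (C * Real.exp (ε / 2 * n)) := by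
        rw [nsmul_eq_mul]
        gcongr
    _ = C * (2 / ε) * Real.exp (ε / 2 * n + ε / 2 * n) := by
        rw [Real.exp_add]
        ring
    _ = _ := by
        rw [Real.norm_eq_abs, Real.abs_exp]
        congr 2
        ring

theorem of_tendsto_log (h0 : ∀ n, u n ≠ 0)
    (h : Tendsto (fun n : ℕ => Real.log ‖u n‖ / n) atTop (𝓝 0)) : IsSubexponential u :=
  fun ε hε => by
    refine Asymptotics.IsBigO.of_bound 1 ?_
    filter_upwards [h.eventually_le_const hε, eventually_gt_atTop 0] with n hn hpos
    have hpos' : (0 : ℝ) < n := by exact_mod_cast hpos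
    rw [div_le_iff₀ hpos', Real.log_le_iff_le_exp (norm_pos_iff.2 (h0 n))] at hn
    rwa [one_mul, Real.norm_eq_abs, Real.abs_exp]

/-- Subexponential growth alone does not control inverses; a logarithmic rate of 0 is a two-sided
condition and does. -/
theorem inv_of_tendsto_log (h0 : ∀ n, u n ≠ 0)
    (h : Tendsto (fun n : ℕ => Real.log ‖u n‖ / n) atTop (𝓝 0)) :
    IsSubexponential fun n => (u n)⁻¹ := by
  refine of_tendsto_log (fun n => inv_ne_zero (h0 n)) ?_
  simpa [norm_inv, Real.log_inv, neg_div] using h.neg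

end IsSubexponential

/-! ### Frobenius norm and determinant of 2 × 2 matrices -/

section Frobenius

open scoped Matrix.Norms.Frobenius

theorem frobenius_norm_sq_fin_two (A : Matrix (Fin 2) (Fin 2) ℂ) :
    ‖A‖ ^ 2 = ‖A 0 0‖ ^ 2 + ‖A 0 1‖ ^ 2 + ‖A 1 0‖ ^ 2 + ‖A 1 1‖ ^ 2 := by
  rw [Matrix.frobenius_norm_def, ← Real.sqrt_eq_rpow, Real.sq_sqrt (by positivity)]
  simp only [Fin.sum_univ_two, Real.rpow_two]
  ring

theorem norm_det_le_frobenius_norm_sq (A : Matrix (Fin 2) (Fin 2) ℂ) : ‖A.det‖ ≤ ‖A‖ ^ 2 := by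
  rw [frobenius_norm_sq_fin_two, Matrix.det_fin_two]
  refine (norm_sub_le _ _).trans ?_
  rw [norm_mul, norm_mul]
  nlinarith [sq_nonneg (‖A 0 0‖ - ‖A 1 1‖), sq_nonneg (‖A 0 1‖ - ‖A 1 0‖),
    sq_nonneg ‖A 0 0‖, sq_nonneg ‖A 0 1‖, sq_nonneg ‖A 1 0‖, sq_nonneg ‖A 1 1‖]

theorem frobenius_norm_adjugate_fin_two (A : Matrix (Fin 2) (Fin 2) ℂ) :
    ‖A.adjugate‖ = ‖A‖ := by
  rw [← sq_eq_sq₀ (norm_nonneg _) (norm_nonneg _), frobenius_norm_sq_fin_two,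
    frobenius_norm_sq_fin_two, Matrix.adjugate_fin_two]
  simp only [Matrix.of_apply, Matrix.cons_val_zero, Matrix.cons_val_one, norm_neg]
  ring

theorem frobenius_norm_inv_fin_two (A : Matrix (Fin 2) (Fin 2) ℂ) :
    ‖A⁻¹‖ = ‖A‖ / ‖A.det‖ := by
  rw [Matrix.inv_def, Ring.inverse_eq_inv', norm_smul, frobenius_norm_adjugate_fin_two, norm_inv,
    div_eq_inv_mul]

theorem frobenius_norm_le_fin_two (A : Matrix (Fin 2) (Fin 2) ℂ) :
    ‖A‖ ≤ ‖A 0 0‖ + ‖A 0 1‖ + ‖A 1 0‖ + ‖A 1 1‖ := by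
  refine le_of_sq_le_sq ?_ (by positivity)
  rw [frobenius_norm_sq_fin_two]
  have h1 := norm_nonneg (A 0 0)
  have h2 := norm_nonneg (A 0 1)
  have h3 := norm_nonneg (A 1 0)
  have h4 := norm_nonneg (A 1 1)
  nlinarith [mul_nonneg h1 h2, mul_nonneg h1 h3, mul_nonneg h1 h4, mul_nonneg h2 h3,
    mul_nonneg h2 h4, mul_nonneg h3 h4]

/-- The entries bound the norm from above, and |det M| ≤ ‖M‖² bounds it from below. -/
theorem tendsto_log_norm_div_of_det {M : ℕ → Matrix (Fin 2) (Fin 2) ℂ}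
    (hM : ∀ i j, IsSubexponential fun n => M n i j) (h0 : ∀ n, (M n).det ≠ 0)
    (hdet : Tendsto (fun n : ℕ => Real.log ‖(M n).det‖ / n) atTop (𝓝 0)) :
    Tendsto (fun n : ℕ => Real.log ‖M n‖ / n) atTop (𝓝 0) := by
  have hpos : ∀ n, 0 < ‖M n‖ := fun n => norm_pos_iff.2 fun h => h0 n (by rw [h]; simp)
  have hO : ∀ ε : ℝ, 0 < ε →
      (fun n => ‖M n 0 0‖ + ‖M n 0 1‖ + ‖M n 1 0‖ + ‖M n 1 1‖)
        =O[atTop] fun n : ℕ => Real.exp (ε * n) := fun ε hε =>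
    (((hM 0 0 ε hε).norm_left.add (hM 0 1 ε hε).norm_left).add (hM 1 0 ε hε).norm_left).add
      (hM 1 1 ε hε).norm_left
  refine tendsto_order.2 ⟨fun a ha => ?_, fun a ha => ?_⟩
  · filter_upwards [hdet.eventually_const_lt (show 2 * a < 0 by linarith),
      eventually_gt_atTop 0] with n hn hn0
    have hn0 : (0 : ℝ) < n := by exact_mod_cast hn0
    have h := Real.log_le_log (norm_pos_iff.2 (h0 n)) (norm_det_le_frobenius_norm_sq (M n))
    rw [Real.log_pow] at h
    rw [lt_div_iff₀ hn0] at hn ⊢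
    push_cast at h
    linarith
  · obtain ⟨C, hC, h⟩ := Asymptotics.bound_of_isBigO_nat_atTop (hO (a / 2) (half_pos ha))
    have hlim := tendsto_const_div_atTop_nhds_zero_nat (Real.log C)
    filter_upwards [hlim.eventually_lt_const (half_pos ha), eventually_gt_atTop 0] with n hn hn0
    have hn0 : (0 : ℝ) < n := by exact_mod_cast hn0
    have h1 : ‖M n‖ ≤ C * Real.exp (a / 2 * n) := by
      refine (frobenius_norm_le_fin_two _).trans ((le_abs_self _).trans ?_)
      simpa using h (Real.exp_ne_zero (a / 2 * n))
    have h2 := Real.log_le_log (hpos n) h1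
    rw [Real.log_mul hC.ne' (Real.exp_ne_zero _), Real.log_exp] at h2
    rw [div_lt_iff₀ hn0] at hn ⊢
    linarith

end Frobenius

/-! ### The Fourier matrix and its cocycle -/

theorem fourierMatrix_constLengthSubst (ℓ : ℕ) (k : ℝ) :
    fourierMatrix (constLengthSubst ℓ) k =
      !![1, ∑ t ∈ Finset.range (ℓ + 1), Complex.exp (2 * Real.pi * Complex.I * k) ^ t;
        ∑ t ∈ Finset.range (ℓ + 1), Complex.exp (2 * Real.pi * Complex.I * k) ^ t - 1, 0] := by
  have he : ∀ t : ℕ, Complex.exp (2 * (Real.pi : ℂ) * Complex.I * (t : ℂ) * (k : ℂ))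
      = Complex.exp (2 * Real.pi * Complex.I * k) ^ t := fun t => by
    rw [← Complex.exp_nat_mul]
    congr 1
    ring
  ext i j
  simp only [fourierMatrix, displacementSet, Finset.sum_filter, he, Matrix.of_apply]
  fin_cases i <;> fin_cases j
  · simp [constLengthSubst, Finset.sum_range_succ', List.getElem?_replicate]
  · simp only [constLengthSubst]
    simp
    refine Finset.sum_congr rfl fun t ht => ?_
    simp_all
  · simp [constLengthSubst, Finset.sum_range_succ', List.getElem?_replicate]
    refine Finset.sum_congr rfl fun t ht => ?_
    simp_all
  · simp [constLengthSubst, List.getElem?_replicate]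

section Cocycle

variable {B : ℝ → Matrix (Fin 2) (Fin 2) ℂ} {lam k : ℝ}

/-- No invertibility is needed: `Matrix.mul_inv_rev` holds for the total matrix inverse. -/
theorem outwardProduct_eq_inv (n : ℕ) :
    outwardProduct B lam k n = (inwardProduct B lam k n)⁻¹ := by
  induction n with
  | zero => simp [outwardProduct, inwardProduct]
  | succ n ih => rw [outwardProduct, inwardProduct, Matrix.mul_inv_rev, ih]

variable {p : ℕ → ℂ}

/-- The cocycle is triangular in the basis adapted to the common left eigenvector `(1, 1)`. -/
theorem inwardProduct_eq (hB : ∀ n, B (lam ^ n * k) = !![1, p n; p n - 1, 0])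
    (hp : ∀ n, p n ≠ 0) (n : ℕ) :
    inwardProduct B lam k n =
      let P := ∏ j ∈ Finset.range n, p j
      let Q := ∏ j ∈ Finset.range n, (1 - p j)
      let C := P * -∑ j ∈ Finset.range n,
        (∏ i ∈ Finset.range (j + 1), (1 - p i)) * (∏ i ∈ Finset.range (j + 1), p i)⁻¹
      !![P - C, P - C - Q; C, C + Q] := by
  induction n with
  | zero => simp [inwardProduct, Matrix.one_fin_two]
  | succ n ih =>
    have hP : ∏ j ∈ Finset.range (n + 1), p j ≠ 0 := Finset.prod_ne_zero_iff.2 fun j _ => hp j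
    simp only at ih ⊢
    set S := ∑ j ∈ Finset.range n,
      (∏ i ∈ Finset.range (j + 1), (1 - p i)) * (∏ i ∈ Finset.range (j + 1), p i)⁻¹ with hS
    -- The lower-left entry obeys C_{n+1} = p_n C_n - Q_{n+1}; the closed form is its solution by
    -- variation of constants.
    have hC : (∏ j ∈ Finset.range (n + 1), p j) * -∑ j ∈ Finset.range (n + 1),
        (∏ i ∈ Finset.range (j + 1), (1 - p i)) * (∏ i ∈ Finset.range (j + 1), p i)⁻¹
        = ((∏ j ∈ Finset.range n, p j) * -S) * p n
          - (∏ j ∈ Finset.range n, (1 - p j)) * (1 - p n) := by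
      rw [Finset.sum_range_succ, ← hS, ← Finset.prod_range_succ (fun j => 1 - p j) n, neg_add,
        mul_add, mul_neg (∏ j ∈ Finset.range (n + 1), p j) (_ * _), mul_left_comm,
        mul_inv_cancel₀ hP, Finset.prod_range_succ p n]
      ring
    rw [inwardProduct, ih, hB, hC, Finset.prod_range_succ, Finset.prod_range_succ,
      Matrix.mul_fin_two]
    congr 1
    ext i j
    fin_cases i <;> fin_cases j <;> simp <;> ring

theorem det_inwardProduct (hB : ∀ n, B (lam ^ n * k) = !![1, p n; p n - 1, 0])
    (n : ℕ) : (inwardProduct B lam k n).det =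
    (∏ j ∈ Finset.range n, p j) * ∏ j ∈ Finset.range n, (1 - p j) := by
  induction n with
  | zero => simp [inwardProduct]
  | succ n ih =>
    rw [inwardProduct, Matrix.det_mul, ih, hB, Matrix.det_fin_two_of, Finset.prod_range_succ,
      Finset.prod_range_succ]
    ring

theorem tendsto_log_norm_det_inwardProduct (hB : ∀ n, B (lam ^ n * k) = !![1, p n; p n - 1, 0])
    (hp : ∀ n, p n ≠ 0) (hq : ∀ n, 1 - p n ≠ 0)
    (hP : Tendsto (fun n : ℕ => Real.log ‖∏ j ∈ Finset.range n, p j‖ / n) atTop (𝓝 0))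
    (hQ : Tendsto (fun n : ℕ => Real.log ‖∏ j ∈ Finset.range n, (1 - p j)‖ / n) atTop (𝓝 0)) :
    Tendsto (fun n : ℕ => Real.log ‖(inwardProduct B lam k n).det‖ / n) atTop (𝓝 0) := by
  have h := hP.add hQ
  rw [add_zero] at h
  refine h.congr fun n => ?_
  rw [det_inwardProduct hB, norm_mul, Real.log_mul, add_div]
  · exact norm_ne_zero_iff.2 (Finset.prod_ne_zero_iff.2 fun j _ => hp j)
  · exact norm_ne_zero_iff.2 (Finset.prod_ne_zero_iff.2 fun j _ => hq j)

theorem isSubexponential_inwardProduct (hB : ∀ n, B (lam ^ n * k) = !![1, p n; p n - 1, 0])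
    (hp : ∀ n, p n ≠ 0) (hq : ∀ n, 1 - p n ≠ 0)
    (hP : Tendsto (fun n : ℕ => Real.log ‖∏ j ∈ Finset.range n, p j‖ / n) atTop (𝓝 0))
    (hQ : Tendsto (fun n : ℕ => Real.log ‖∏ j ∈ Finset.range n, (1 - p j)‖ / n) atTop (𝓝 0))
    (i j : Fin 2) : IsSubexponential fun n => inwardProduct B lam k n i j := by
  have hP0 : ∀ n, ∏ j ∈ Finset.range n, p j ≠ 0 := fun n =>
    Finset.prod_ne_zero_iff.2 fun j _ => hp j
  have sP := IsSubexponential.of_tendsto_log hP0 hP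
  have sP' := IsSubexponential.inv_of_tendsto_log hP0 hP
  have sQ := IsSubexponential.of_tendsto_log
    (fun n => Finset.prod_ne_zero_iff.2 fun j _ => hq j) hQ
  have sC := sP.mul (sQ.comp_add_one.mul sP'.comp_add_one).sum_range.neg
  simp only [inwardProduct_eq hB hp]
  fin_cases i <;> fin_cases j
  · exact sP.sub sC
  · exact (sP.sub sC).sub sQ
  · exact sC
  · exact sC.add sQ

open scoped Matrix.Norms.Frobenius in
theorem chi_eq_of_tendsto (hB : ∀ n, B (lam ^ n * k) = !![1, p n; p n - 1, 0])
    (hp : ∀ n, p n ≠ 0) (hq : ∀ n, 1 - p n ≠ 0)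
    (hP : Tendsto (fun n : ℕ => Real.log ‖∏ j ∈ Finset.range n, p j‖ / n) atTop (𝓝 0))
    (hQ : Tendsto (fun n : ℕ => Real.log ‖∏ j ∈ Finset.range n, (1 - p j)‖ / n) atTop (𝓝 0)) :
    chiMin B lam k = (Real.log (Real.sqrt lam) : ℝ) ∧
      chiMax B lam k = (Real.log (Real.sqrt lam) : ℝ) := by
  have hdet0 : ∀ n, (inwardProduct B lam k n).det ≠ 0 := fun n => by
    rw [det_inwardProduct hB]
    exact mul_ne_zero (Finset.prod_ne_zero_iff.2 fun j _ => hp j)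
      (Finset.prod_ne_zero_iff.2 fun j _ => hq j)
  have hdet := tendsto_log_norm_det_inwardProduct hB hp hq hP hQ
  have hin := tendsto_log_norm_div_of_det (isSubexponential_inwardProduct hB hp hq hP hQ) hdet0 hdet
  have hout : Tendsto (fun n : ℕ => Real.log ‖outwardProduct B lam k n‖ / n) atTop (𝓝 0) := by
    have h := hin.sub hdet
    rw [sub_zero] at h
    refine h.congr fun n => ?_
    have hM : ‖inwardProduct B lam k n‖ ≠ 0 :=
      norm_ne_zero_iff.2 fun h => hdet0 n (by rw [h]; simp)
    rw [outwardProduct_eq_inv, frobenius_norm_inv_fin_two,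
      Real.log_div hM (norm_ne_zero_iff.2 (hdet0 n)), sub_div]
  have hin' := ((continuous_coe_real_ereal.tendsto 0).comp hin).limsup_eq
  have hout' := ((continuous_coe_real_ereal.tendsto 0).comp hout).limsup_eq
  simp only [Function.comp_def] at hin' hout'
  simp only [chiMin, chiMax, one_div_mul_eq_div, hin', hout']
  simp

end Cocycle

/-! ### Diagonal products and the conclusion -/

theorem tendsto_log_norm_prod_div {u : ℕ → ℂ} {a b : ℕ → ℝ} (hu : ∀ j, u j ≠ 0)
    (h : ∀ j, Real.log ‖u j‖ = a j - b j)
    (ha : Tendsto (fun n : ℕ => (∑ j ∈ Finset.range n, a j) / n) atTop (𝓝 0))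
    (hb : Tendsto (fun n : ℕ => (∑ j ∈ Finset.range n, b j) / n) atTop (𝓝 0)) :
    Tendsto (fun n : ℕ => Real.log ‖∏ j ∈ Finset.range n, u j‖ / n) atTop (𝓝 0) := by
  have hab := ha.sub hb
  rw [sub_zero] at hab
  refine hab.congr fun n => ?_
  rw [norm_prod, Real.log_prod fun j _ => norm_ne_zero_iff.2 (hu j),
    Finset.sum_congr rfl fun j _ => h j, Finset.sum_sub_distrib, sub_div]

theorem exp_two_pi_mul_I_ne_one {x : ℝ} (hx : Irrational x) :
    Complex.exp (2 * Real.pi * Complex.I * x) ≠ 1 := fun h => by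
  obtain ⟨n, hn⟩ := Complex.exp_eq_one_iff.1 h
  rw [mul_comm] at hn
  have := mul_right_cancel₀ Complex.two_pi_I_ne_zero hn
  exact hx ⟨n, by exact_mod_cast this.symm⟩

theorem mainTheorem9 (ℓ : ℕ) (hℓ : 1 ≤ ℓ) :
    ∀ᵐ k : ℝ ∂MeasureTheory.volume,
      (∀ n : ℕ, IsUnit (fourierMatrix (constLengthSubst ℓ) (((ℓ : ℝ) + 1) ^ n * k)).det) ∧
      chiMin (fourierMatrix (constLengthSubst ℓ)) ((ℓ : ℝ) + 1) k =
        chiMax (fourierMatrix (constLengthSubst ℓ)) ((ℓ : ℝ) + 1) k ∧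
      chiMax (fourierMatrix (constLengthSubst ℓ)) ((ℓ : ℝ) + 1) k =
        ((Real.log (Real.sqrt ((ℓ : ℝ) + 1)) : ℝ) : EReal) := by
  have hlam : 1 < ℓ + 1 := by lia
  -- Irrationality of k keeps m (ℓ+1)^j k out of ℤ for all j and all m ≠ 0 at once, so no factor 1 -
  -- z_j^m vanishes.
  have hirr : ∀ᵐ k : ℝ, Irrational k := (Set.countable_range ((↑) : ℚ → ℝ)).ae_notMem volume
  filter_upwards [hirr, ae_tendsto_average_log_norm_one_sub_exp hlam one_ne_zero,
    ae_tendsto_average_log_norm_one_sub_exp hlam (show ℓ ≠ 0 by lia),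
    ae_tendsto_average_log_norm_one_sub_exp hlam (show ℓ + 1 ≠ 0 by lia)] with k hk h1 hl hl1
  push_cast at h1 hl hl1
  set z : ℕ → ℂ := fun j =>
    Complex.exp (2 * Real.pi * Complex.I * ((((ℓ : ℝ) + 1) ^ j * k : ℝ) : ℂ)) with hz
  set p : ℕ → ℂ := fun j => ∑ t ∈ Finset.range (ℓ + 1), z j ^ t with hp
  have hB : ∀ n, fourierMatrix (constLengthSubst ℓ) (((ℓ : ℝ) + 1) ^ n * k)
      = !![1, p n; p n - 1, 0] := fun n => fourierMatrix_constLengthSubst ℓ _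
  have hzpow : ∀ m j : ℕ, z j ^ m =
      Complex.exp (2 * Real.pi * Complex.I * ((m : ℂ) * (((ℓ : ℂ) + 1) ^ j * k))) := fun m j => by
    rw [hz, ← Complex.exp_nat_mul]
    congr 1
    push_cast
    ring
  have hne : ∀ m j : ℕ, m ≠ 0 → 1 - z j ^ m ≠ 0 := fun m j hm => by
    have h : Irrational (((m * (ℓ + 1) ^ j : ℕ) : ℝ) * k) := hk.natCast_mul (by positivity)
    have h' := exp_two_pi_mul_I_ne_one h
    rw [sub_ne_zero, hzpow]
    convert! h'.symm using 4
    push_cast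
    ring
  have hne1 : ∀ j, 1 - z j ≠ 0 := fun j => by simpa using hne 1 j one_ne_zero
  have hpz : ∀ j, p j = (1 - z j ^ (ℓ + 1)) / (1 - z j) := fun j => by
    rw [eq_div_iff (hne1 j), mul_comm, hp, mul_neg_geom_sum]
  have hqz : ∀ j, 1 - p j = -(z j * (1 - z j ^ ℓ)) / (1 - z j) := fun j => by
    rw [hpz]
    field_simp [hne1 j]
    ring
  have hz1 : ∀ j, ‖z j‖ = 1 := fun j => by
    rw [Complex.norm_exp, Complex.re_mul_ofReal]
    simp
  have hp0 : ∀ j, p j ≠ 0 := fun j => by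
    rw [hpz]
    exact div_ne_zero (hne _ j (by lia)) (hne1 j)
  have hq0 : ∀ j, 1 - p j ≠ 0 := fun j => by
    rw [hqz]
    exact div_ne_zero (neg_ne_zero.2 (mul_ne_zero (Complex.exp_ne_zero _) (hne _ j (by lia))))
      (hne1 j)
  have avg : ∀ m : ℕ, Tendsto (fun n : ℕ => (∑ j ∈ Finset.range n, Real.log
      ‖1 - Complex.exp (2 * Real.pi * Complex.I * ((m : ℂ) * (((ℓ : ℂ) + 1) ^ j * k)))‖) / n)
        atTop (𝓝 0) → Tendsto (fun n : ℕ => (∑ j ∈ Finset.range n, Real.log ‖1 - z j ^ m‖) / n)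
        atTop (𝓝 0) := fun m h => by simpa only [hzpow] using h
  have a1 := avg 1 (by simpa using h1)
  simp only [pow_one] at a1
  have hP := tendsto_log_norm_prod_div hp0 (fun j => by
    rw [hpz, norm_div, Real.log_div (norm_ne_zero_iff.2 (hne _ j (by lia)))
      (norm_ne_zero_iff.2 (hne1 j))]) (avg (ℓ + 1) (by simpa using hl1)) a1
  have hQ := tendsto_log_norm_prod_div hq0 (fun j => by
    rw [hqz, norm_div, norm_neg, norm_mul, hz1, one_mul,
      Real.log_div (norm_ne_zero_iff.2 (hne _ j (by lia)))
      (norm_ne_zero_iff.2 (hne1 j))]) (avg ℓ hl) a1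
  obtain ⟨hmin, hmax⟩ := chi_eq_of_tendsto hB hp0 hq0 hP hQ
  refine ⟨fun n => ?_, hmin.trans hmax.symm, hmax⟩
  rw [hB, Matrix.det_fin_two_of, isUnit_iff_ne_zero]
  have := mul_ne_zero (hp0 n) (hq0 n)
  intro h
  apply this
  linear_combination h
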